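/- Let $A\in\mathbb R^{d\times d}$ be regular, $\Lambda=A\mathbb Z^d$ the lattice it generates and $\Lambda^*=A^{-T}\mathbb Z^d$ its reciprocal lattice. For $x,y\in\mathbb R^d$ the Epstein zeta function $\nu\mapsto Z_{\Lambda,\nu}(x,y)$ is the meromorphic continuation to $\nu\in\mathbb C$ of the lattice sum $$Z_{\Lambda,\nu}(x,y)=\sum_{z\in\Lambda,\ z\neq x}\frac{e^{-2\pi i\,y\cdot z}}{|x-z|^{\nu}},\qquad \operatorname{Re}\nu>d .$$ Let $x,y\in\mathbb R^d$ and $\nu\in\mathbb C$, with $\nu\ne d$ if $y\in\Lambda^*$. Then $Z$ is well defined: the lattice sum converges absolutely for all exponents of real part greater than $d$, it has a meromorphic continuation to $\mathbb C$, and this continuation is holomorphic at $\nu$. Moreover: 1. (Inversion) $Z_{\Lambda,\nu}(-x,y)=Z_{\Lambda,\nu}(x,-y)$ and $Z_{\Lambda,\nu}(-x,-y)=Z_{\Lambda,\nu}(x,y)$. 2. (Translation) For all $u\in\Lambda$ and $v\in\Lambda^*$, $Z_{\Lambda,\nu}(x+u,y+v)=e^{-2\pi i\,y\cdot u}\,Z_{\Lambda,\nu}(x,y)$.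 3. (Scale) For all $s\in\mathbb R\setminus\{0\}$, $Z_{\Lambda,\nu}(x,y)=|s|^{\nu}\,Z_{s\Lambda,\nu}(sx,y/s)$. -/

import Mathlib

open scoped Matrix Pointwise

noncomputable section

/-- The lattice `Λ = A ℤᵈ` generated by the columns of a matrix `A` (used for `det A ≠ 0`). -/
def lattice {d : ℕ} (A : Matrix (Fin d) (Fin d) ℝ) : Set (EuclideanSpace ℝ (Fin d)) :=
  {z | ∃ n : Fin d → ℤ, z = WithLp.toLp 2 (A *ᵥ fun i => (n i : ℝ))}

/-- The reciprocal lattice `Λ* = A⁻ᵀ ℤᵈ` of `Λ = A ℤᵈ`. -/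
def reciprocalLattice {d : ℕ} (A : Matrix (Fin d) (Fin d) ℝ) : Set (EuclideanSpace ℝ (Fin d)) :=
  lattice (A⁻¹)ᵀ

/-- The summand `e^{-2πi y·z} / |x - z|^ν`. -/
def epsteinSummand {d : ℕ} (x y : EuclideanSpace ℝ (Fin d)) (ν : ℂ)
    (z : EuclideanSpace ℝ (Fin d)) : ℂ :=
  Complex.exp (-2 * Real.pi * Complex.I * (inner ℝ y z : ℝ)) / ((‖x - z‖ : ℝ) : ℂ) ^ ν

/-- `f` is the meromorphic continuation to `ℂ` of the lattice sum
`ν ↦ ∑_{z ∈ Λ, z ≠ x} e^{-2πi y·z} / |x - z|^ν`, `Re ν > d`, which is required to converge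
(unconditionally, i.e. absolutely). Normal form means that removable singularities are filled in,
and that `f` has the conventional value `0` at its poles. -/
def IsEpsteinContinuation {d : ℕ} (Λ : Set (EuclideanSpace ℝ (Fin d)))
    (x y : EuclideanSpace ℝ (Fin d)) (f : ℂ → ℂ) : Prop :=
  MeromorphicNFOn f Set.univ ∧
    ∀ ν : ℂ, (d : ℝ) < ν.re →
      HasSum (fun z : ↥(Λ \ {x}) => epsteinSummand x y ν z) (f ν)

/-- There is at most one meromorphic continuation. -/
theorem IsEpsteinContinuation.unique {d : ℕ} {Λ : Set (EuclideanSpace ℝ (Fin d))}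
    {x y : EuclideanSpace ℝ (Fin d)} {f g : ℂ → ℂ}
    (hf : IsEpsteinContinuation Λ x y f) (hg : IsEpsteinContinuation Λ x y g) : f = g := by
  obtain ⟨hf1, hf2⟩ := hf
  obtain ⟨hg1, hg2⟩ := hg
  have hm : MeromorphicOn (f - g) Set.univ := hf1.meromorphicOn.sub hg1.meromorphicOn
  have h0 : meromorphicOrderAt (f - g) (((d : ℝ) + 1 : ℝ) : ℂ) = ⊤ := by
    rw [meromorphicOrderAt_eq_top_iff]
    have ho : IsOpen {ν : ℂ | (d : ℝ) < ν.re} := isOpen_lt continuous_const Complex.continuous_re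
    have hmem : (((d : ℝ) + 1 : ℝ) : ℂ) ∈ {ν : ℂ | (d : ℝ) < ν.re} := by simp
    filter_upwards [mem_nhdsWithin_of_mem_nhds (ho.mem_nhds hmem)] with ν hν
    simp [(hf2 ν hν).unique (hg2 ν hν)]
  funext ν
  have h1 : meromorphicOrderAt (f - g) ν = ⊤ := by
    by_contra h
    exact hm.meromorphicOrderAt_ne_top_of_isPreconnected isPreconnected_univ
      (Set.mem_univ ν) (Set.mem_univ _) h h0
  rw [meromorphicOrderAt_eq_top_iff] at h1
  have h2 : f =ᶠ[nhdsWithin ν {ν}ᶜ] g := by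
    filter_upwards [h1] with w hw using sub_eq_zero.mp hw
  exact ((MeromorphicNFAt.eventuallyEq_nhdsNE_iff_eventuallyEq_nhds
    (hf1 (Set.mem_univ ν)) (hg1 (Set.mem_univ ν))).mp h2).eq_of_nhds

open Classical in
/-- The Epstein zeta function `Z_{Λ,ν}(x, y)`, as a function of `ν`: the meromorphic continuation
to `ℂ` of its lattice sum. -/
def epsteinZeta {d : ℕ} (Λ : Set (EuclideanSpace ℝ (Fin d)))
    (x y : EuclideanSpace ℝ (Fin d)) : ℂ → ℂ :=
  if h : ∃ f, IsEpsteinContinuation Λ x y f then h.choose else 0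

end

/-! This is Riemann's method. The Gaussian theta series θ(t) = ∑ e^{-2πi y·z} e^{-π|x-z|²t} over Λ
satisfies, by Poisson summation, a functional equation relating θ(1/t) to t^{d/2} times the theta
series of Λ* with (x, y) replaced by (-y, x) (`epsteinTheta_one_div`). As t → ∞, each series
approaches its constant term faster than any power of t. Hence the Mellin transform of θ minus its
constant, at s = ν/2, continues to ℂ with at most simple poles: at s = 0, from the constant of θ
(nonzero only if x ∈ Λ), and at s = d/2, from the dual constant (nonzero only if y ∈ Λ*).

For Re ν > d, termwise integration turns this transform into π^{-ν/2} Γ(ν/2) times the lattice sum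
(`hasSum_epsteinContinuation`). Dividing by the Gamma factor cancels the pole at 0, so only ν = d
can remain.

The symmetries need no analysis beyond uniqueness of the continuation: z ↦ -z, z ↦ z - u and z ↦ sz
are bijections of punctured lattices that match summands up to a zero-free entire factor
(`IsEpsteinContinuation.mul_of_equiv`). -/

open MeasureTheory Filter

/-! ### Poisson summation over `ℤᵈ` -/

/-- The translates by `ℤᵈ` of the half-open unit cube partition `ℝᵈ`, so the integrals over the
cube of the translates of `f` add up to the integral of `f`. -/
theorem hasSum_integral_unitCube_translate {d : ℕ} {f : (Fin d → ℝ) → ℂ} (hf : Integrable f) :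
    HasSum (fun n : Fin d → ℤ =>
      ∫ v in {v : Fin d → ℝ | ∀ i, v i ∈ Set.Ioc ((0 : Fin d → ℝ) i) ((0 : Fin d → ℝ) i + 1)},
        f (v + fun i => (n i : ℝ))) (∫ v, f v) := by
  set C : Set (Fin d → ℝ) :=
    {v : Fin d → ℝ | ∀ i, v i ∈ Set.Ioc ((0 : Fin d → ℝ) i) ((0 : Fin d → ℝ) i + 1)} with hC
  have hCm : MeasurableSet C := MeasurableSet.univ_pi' fun i => measurableSet_Ioc
  let S : (Fin d → ℤ) → Set (Fin d → ℝ) := fun n => (fun v => v - fun i => (n i : ℝ)) ⁻¹' C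
  have hSm : ∀ n, MeasurableSet (S n) := fun n => (measurable_sub_const _) hCm
  -- The cube is open on the left and closed on the right, so the translate containing v has index
  -- ⌈v⌉ - 1, not ⌊v⌋.
  have hmem : ∀ (n : Fin d → ℤ) v, v ∈ S n ↔ ∀ i, n i = ⌈v i⌉ - 1 := by
    intro n v
    simp only [S, hC, Set.mem_preimage, Set.mem_ofPred_eq, Set.mem_Ioc, Pi.sub_apply, Pi.zero_apply]
    refine forall_congr' fun i => ?_
    rw [eq_sub_iff_add_eq, eq_comm, Int.ceil_eq_iff]
    push_cast
    constructor <;> rintro ⟨h1, h2⟩ <;> constructor <;> linarith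
  have hdisj : Pairwise (Function.onFun Disjoint S) := by
    intro m n hmn
    refine Set.disjoint_left.mpr fun v hm hn => hmn (funext fun i => ?_)
    rw [(hmem m v).mp hm i, (hmem n v).mp hn i]
  have hU : ⋃ n, S n = Set.univ := by
    refine Set.eq_univ_of_forall fun v => Set.mem_iUnion.mpr ⟨fun i => ⌈v i⌉ - 1, ?_⟩
    exact (hmem _ v).mpr fun i => rfl
  have key := hasSum_integral_iUnion (μ := volume) (f := f) hSm hdisj hf.integrableOn
  rw [hU, setIntegral_univ] at key
  refine key.congr_fun fun n => ?_
  have hmp : MeasurePreserving (fun v : Fin d → ℝ => v + fun i => (n i : ℝ)) volume volume :=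
    measurePreserving_add_right volume _
  have := hmp.setIntegral_preimage_emb (measurableEmbedding_addRight _) f (S n)
  rw [← this]
  congr 2
  ext v
  simp [S]

/-- The projection `ℝᵈ → (ℝ/ℤ)ᵈ` is an open quotient map. -/
theorem isOpenQuotientMap_coe_unitAddTorus (d : ℕ) :
    IsOpenQuotientMap (fun (v : Fin d → ℝ) => (fun i => (v i : UnitAddCircle) : UnitAddTorus (Fin d))) :=
  IsOpenQuotientMap.piMap fun _ => QuotientAddGroup.isOpenQuotientMap_mk

theorem mFourier_coe {d : ℕ} (m : Fin d → ℤ) (v : Fin d → ℝ) :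
    UnitAddTorus.mFourier m (fun i => (v i : UnitAddCircle)) =
      Complex.exp (2 * Real.pi * Complex.I * (∑ i, (m i : ℝ) * v i : ℝ)) := by
  simp only [UnitAddTorus.mFourier, ContinuousMap.coe_mk, fourier_coe_apply]
  rw [← Complex.exp_sum]
  congr 1
  push_cast
  rw [Finset.mul_sum]
  refine Finset.sum_congr rfl fun i _ => ?_
  ring

/-- Poisson summation for functions on `ℝᵈ`, over the lattice `ℤᵈ`. -/
theorem hasSum_fourier_of_hasSum_translates {d : ℕ} {h : (Fin d → ℝ) → ℂ}
    (hi : Integrable h) {F : (Fin d → ℝ) → ℂ} (hFc : Continuous F)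
    (hF : ∀ v, HasSum (fun n : Fin d → ℤ => h (v + fun i => (n i : ℝ))) (F v))
    {c : (Fin d → ℤ) → ℂ} (hc' : ∀ m, c m = ∫ v : Fin d → ℝ,
      Complex.exp (-(2 * Real.pi * Complex.I * (∑ i, (m i : ℝ) * v i : ℝ))) * h v)
    (hs : Summable c) (v : Fin d → ℝ) :
    HasSum (fun m => c m * Complex.exp (2 * Real.pi * Complex.I * (∑ i, (m i : ℝ) * v i : ℝ)))
      (F v) := by
  have hq := isOpenQuotientMap_coe_unitAddTorus d
  have hper : ∀ (v : Fin d → ℝ) (k : Fin d → ℤ), F (v + fun i => (k i : ℝ)) = F v := by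
    intro v k
    refine (hF _).unique ?_
    refine ((Equiv.addLeft k).hasSum_iff.mpr (hF v)).congr_fun fun n => ?_
    simp only [Function.comp_apply, Equiv.coe_addLeft, Pi.add_apply, Int.cast_add]
    congr 1
    ext i
    simp [add_assoc]
  let P : C(Fin d → ℝ, UnitAddTorus (Fin d)) := ⟨_, hq.continuous⟩
  -- Two points with the same image in the torus differ by an integer vector, so the periodic F
  -- descends to a continuous G.
  have hfac : Function.FactorsThrough (⟨F, hFc⟩ : C(Fin d → ℝ, ℂ)) P := by
    intro v w hvw
    have : ∀ i, ∃ k : ℤ, w i = v i + k := by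
      intro i
      have := congrFun hvw i
      change ((v i : ℝ) : UnitAddCircle) = (w i : ℝ) at this
      rw [eq_comm, ← sub_eq_zero, ← AddCircle.coe_sub, AddCircle.coe_eq_zero_iff] at this
      obtain ⟨k, hk⟩ := this
      exact ⟨k, by rw [zsmul_eq_mul, mul_one] at hk; linarith⟩
    choose k hk using this
    change F v = F w
    rw [← hper v k]
    congr 1
    ext i
    simp [hk]
  let G : C(UnitAddTorus (Fin d), ℂ) := hq.isQuotientMap.lift (f := P) ⟨F, hFc⟩ hfac
  have hG : ∀ v : Fin d → ℝ, G (fun i => (v i : UnitAddCircle)) = F v := fun v =>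
    DFunLike.congr_fun (hq.isQuotientMap.lift_comp (f := P) ⟨F, hFc⟩ hfac) v
  -- Unfolding: the Fourier coefficient of G is an integral over the unit cube of a sum over
  -- translates. Sum and integral are exchanged because the integrals of |h| over the translated
  -- cubes are summable; periodicity of the character e then reassembles the integral over `ℝᵈ`.
  have hcoeff : UnitAddTorus.mFourierCoeff G = c := by
    funext m
    rw [UnitAddTorus.mFourierCoeff_eq_integral _ m 0]
    set C : Set (Fin d → ℝ) :=
      {v : Fin d → ℝ | ∀ i, v i ∈ Set.Ioc ((0 : Fin d → ℝ) i) ((0 : Fin d → ℝ) i + 1)} with hC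
    let e : (Fin d → ℝ) → ℂ := fun v =>
      Complex.exp (-(2 * Real.pi * Complex.I * (∑ i, (m i : ℝ) * v i : ℝ)))
    have hec : Continuous e := by fun_prop
    have hen : ∀ v, ‖e v‖ = 1 := fun v => by
      simp only [e]
      rw [Complex.norm_exp]
      simp
    have hint : Integrable (fun v => e v * h v) := by
      refine hi.bdd_mul (c := 1) hec.aestronglyMeasurable ?_
      exact Filter.Eventually.of_forall fun v => (hen v).le
    have heper : ∀ v (n : Fin d → ℤ), e (v + fun i => (n i : ℝ)) = e v := by
      intro v n
      simp only [e]
      rw [Complex.exp_eq_exp_iff_exists_int]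
      refine ⟨-∑ i, m i * n i, ?_⟩
      push_cast
      simp only [Pi.add_apply, Complex.ofReal_add, mul_add, Finset.sum_add_distrib,
        Complex.ofReal_intCast]
      ring
    have hbase := hasSum_integral_unitCube_translate hint
    have hnorm := (hasSum_integral_unitCube_translate (f := fun v => ((‖h v‖ : ℝ) : ℂ))
      hi.norm.ofReal).summable
    have hintn : ∀ n : Fin d → ℤ, Integrable (fun v => h (v + fun i => (n i : ℝ))) := fun n =>
      hi.comp_add_right _
    have hswap := hasSum_integral_of_summable_integral_norm (μ := volume.restrict C)
      (F := fun (n : Fin d → ℤ) v => e v * h (v + fun i => (n i : ℝ)))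
      (fun n => by
        refine Integrable.integrableOn ?_
        refine (hintn n).bdd_mul (c := 1) hec.aestronglyMeasurable ?_
        exact Filter.Eventually.of_forall fun v => (hen v).le)
      (by
        simp only [norm_mul, hen, one_mul]
        rw [← Complex.summable_ofReal]
        exact hnorm.congr fun n => integral_ofReal)
    simp only [heper] at hbase
    rw [hc' m, hbase.unique hswap]
    refine setIntegral_congr_fun (MeasurableSet.univ_pi' fun i => measurableSet_Ioc) fun v _ => ?_
    rw [((hF v).mul_left (e v)).tsum_eq, hG, mFourier_coe, smul_eq_mul]
    congr 2
    simp
  have := UnitAddTorus.hasSum_mFourier_series_apply_of_summable (f := G) (hcoeff ▸ hs)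
    (fun i => (v i : UnitAddCircle))
  rw [hcoeff, hG] at this
  simpa only [mFourier_coe, smul_eq_mul] using this

/-! ### Lattice points, duality and convergence of lattice sums -/

/-- The linear map `v ↦ A v`, with values in Euclidean space. -/
def latticeMap {d : ℕ} (A : Matrix (Fin d) (Fin d) ℝ) : (Fin d → ℝ) →ₗ[ℝ] EuclideanSpace ℝ (Fin d) :=
  (WithLp.linearEquiv 2 ℝ (Fin d → ℝ)).symm.toLinearMap ∘ₗ Matrix.toLin' A

/-- The lattice point with integer coordinates `n`. -/
def latticePoint {d : ℕ} (A : Matrix (Fin d) (Fin d) ℝ) (n : Fin d → ℤ) : EuclideanSpace ℝ (Fin d) :=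
  latticeMap A fun i => (n i : ℝ)

section lattice

variable {d : ℕ} {A : Matrix (Fin d) (Fin d) ℝ}

theorem latticeMap_apply (v : Fin d → ℝ) : latticeMap A v = WithLp.toLp 2 (A *ᵥ v) := rfl

theorem mem_lattice_iff {z : EuclideanSpace ℝ (Fin d)} :
    z ∈ lattice A ↔ ∃ n, latticePoint A n = z :=
  exists_congr fun _ => eq_comm

theorem lattice_eq_range : lattice A = Set.range (latticePoint A) :=
  Set.ext fun _ => mem_lattice_iff

theorem continuous_latticeMap : Continuous (latticeMap A) :=
  LinearMap.continuous_of_finiteDimensional _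

theorem latticeMap_injective (hA : A.det ≠ 0) : Function.Injective (latticeMap A) := by
  intro v w h
  have h' : A *ᵥ v = A *ᵥ w := congrArg WithLp.ofLp h
  exact Matrix.mulVec_injective_of_isUnit ((Matrix.isUnit_iff_isUnit_det A).mpr hA.isUnit) h'

theorem latticePoint_injective (hA : A.det ≠ 0) : Function.Injective (latticePoint A) := by
  intro m n h
  have := latticeMap_injective hA h
  exact funext fun i => by exact_mod_cast congrFun this i

theorem latticePoint_add (m n : Fin d → ℤ) :
    latticePoint A (m + n) = latticePoint A m + latticePoint A n := by
  rw [latticePoint, latticePoint, latticePoint, ← map_add]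
  congr 1
  ext i
  simp

theorem latticePoint_neg (n : Fin d → ℤ) : latticePoint A (-n) = -latticePoint A n := by
  rw [latticePoint, latticePoint, ← map_neg]
  congr 1
  ext i
  simp

theorem det_transpose_inv_ne_zero (hA : A.det ≠ 0) : ((A⁻¹)ᵀ).det ≠ 0 := by
  rw [Matrix.det_transpose]
  exact ((Matrix.isUnit_nonsing_inv_det_iff).mpr hA.isUnit).ne_zero

theorem inner_latticeMap (hA : A.det ≠ 0) (u v : Fin d → ℝ) :
    inner ℝ (latticeMap (A⁻¹)ᵀ u) (latticeMap A v) = ∑ i, u i * v i := by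
  rw [latticeMap_apply, latticeMap_apply, EuclideanSpace.inner_toLp_toLp, star_trivial,
    Matrix.mulVec_transpose, dotProduct_comm, ← Matrix.dotProduct_mulVec, Matrix.mulVec_mulVec,
    Matrix.nonsing_inv_mul _ hA.isUnit, Matrix.one_mulVec]
  rfl

/-- The points Az lie in the ℤ-span of a basis of the space, a lattice of rank d, where the power
sum converges for every exponent below -d. -/
theorem summable_norm_latticePoint_sub_rpow (hA : A.det ≠ 0) {r : ℝ} (hr : r < -d)
    (x : EuclideanSpace ℝ (Fin d)) : Summable fun n => ‖x - latticePoint A n‖ ^ r := by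
  let e : (Fin d → ℝ) ≃ₗ[ℝ] EuclideanSpace ℝ (Fin d) :=
    LinearEquiv.ofInjectiveOfFinrankEq (latticeMap A) (latticeMap_injective hA) (by simp)
  let b := (Pi.basisFun ℝ (Fin d)).map e
  let L := Submodule.span ℤ (Set.range b)
  have hL : Module.finrank ℤ L = d := by
    rw [ZLattice.rank ℝ L]
    simp
  have hmem : ∀ n, latticePoint A n ∈ L := by
    intro n
    have : latticePoint A n = ∑ i, n i • b i := by
      have h1 : (fun i => (n i : ℝ)) = ∑ i, (n i : ℝ) • Pi.basisFun ℝ (Fin d) i := by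
        ext j
        simp [Finset.sum_apply, Pi.single_apply]
      rw [latticePoint, h1, map_sum]
      refine Finset.sum_congr rfl fun i _ => ?_
      rw [map_smul, Int.cast_smul_eq_zsmul]
      rfl
    rw [this]
    exact Submodule.sum_mem _ fun i _ => Submodule.smul_mem _ _ (Submodule.subset_span ⟨i, rfl⟩)
  have := ZLattice.summable_norm_sub_rpow L r (by rwa [hL]) x
  have h2 := this.comp_injective (i := fun n => (⟨latticePoint A n, hmem n⟩ : L))
    fun m n h => latticePoint_injective hA (congrArg Subtype.val h)
  refine h2.congr fun n => ?_
  rw [norm_sub_rev]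
  rfl

/-- Invert (cr²)^N / N! ≤ e^{cr²}. The bound serves twice: for fixed c it gives summability over the
lattice, and for c = πt it gives decay in t. -/
theorem exp_neg_mul_sq_le {c r : ℝ} (hc : 0 < c) (hr : r ≠ 0) (N : ℕ) :
    Real.exp (-c * r ^ 2) ≤ N.factorial / c ^ N * |r| ^ (-(2 * N : ℝ)) := by
  have hr' : 0 < |r| := abs_pos.mpr hr
  have h1 := Real.pow_div_factorial_le_exp (c * r ^ 2) (by positivity) N
  rw [neg_mul, Real.exp_neg, Real.rpow_neg hr'.le]
  have h2 : |r| ^ (2 * N : ℝ) = (r ^ 2) ^ N := by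
    rw [← sq_abs, ← pow_mul, ← Real.rpow_natCast]
    push_cast
    rfl
  rw [h2]
  have h3 : 0 < (c * r ^ 2) ^ N / N.factorial := by positivity
  calc (Real.exp (c * r ^ 2))⁻¹ ≤ ((c * r ^ 2) ^ N / N.factorial)⁻¹ := inv_anti₀ h3 h1
    _ = _ := by rw [mul_pow, inv_div, div_mul_eq_div_div, div_eq_mul_inv _ ((r ^ 2) ^ N)]

theorem summable_exp_neg_norm_latticePoint_sub_sq (hA : A.det ≠ 0) {c : ℝ} (hc : 0 < c)
    (x : EuclideanSpace ℝ (Fin d)) :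
    Summable fun n => Real.exp (-c * ‖x - latticePoint A n‖ ^ 2) := by
  have hs := (summable_norm_latticePoint_sub_rpow hA (r := -(2 * (d + 1 : ℕ) : ℝ))
    (by push_cast; linarith [(Nat.cast_nonneg d : (0 : ℝ) ≤ d)]) x).mul_left
    ((d + 1).factorial / c ^ (d + 1) : ℝ)
  -- The comparison fails where x is the lattice point: the power of 0 is 0 but the exponential is
  -- 1. Injectivity leaves at most one such index.
  refine hs.of_norm_bounded_eventually ?_
  have hfin : {n | latticePoint A n = x}.Finite :=
    Set.Subsingleton.finite fun m hm n hn => latticePoint_injective hA (hm.trans hn.symm)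
  refine hfin.subset fun n hn => ?_
  by_contra hne
  refine hn ?_
  have hne' : ‖x - latticePoint A n‖ ≠ 0 := norm_ne_zero_iff.mpr (sub_ne_zero.mpr (Ne.symm hne))
  simpa using exp_neg_mul_sq_le hc hne' (d + 1)

end lattice

/-! ### Poisson summation for modulated Gaussians -/

section gaussian

variable {d : ℕ} {A : Matrix (Fin d) (Fin d) ℝ}

theorem integrable_comp_latticeMap (hA : A.det ≠ 0) {g : EuclideanSpace ℝ (Fin d) → ℂ}
    (hg : Integrable g) : Integrable fun v => g (latticeMap A v) := by
  have hemb : MeasurableEmbedding (Matrix.toLin' A) :=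
    (LinearMap.continuous_of_finiteDimensional (Matrix.toLin' A)).measurableEmbedding
      (Matrix.mulVec_injective_of_isUnit ((Matrix.isUnit_iff_isUnit_det A).mpr hA.isUnit))
  have h1 : Integrable (fun v : Fin d → ℝ => g (WithLp.toLp 2 v)) :=
    ((PiLp.volume_preserving_toLp (Fin d)).integrable_comp_emb
      (MeasurableEquiv.toLp 2 _).measurableEmbedding).mpr hg
  refine (hemb.integrable_map_iff (g := fun v : Fin d → ℝ => g (WithLp.toLp 2 v))).mp ?_
  rw [Real.map_matrix_volume_pi_eq_smul_volume_pi hA]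
  exact h1.smul_measure ENNReal.ofReal_ne_top

theorem integral_comp_latticeMap (hA : A.det ≠ 0) (g : EuclideanSpace ℝ (Fin d) → ℂ) :
    ∫ v, g (latticeMap A v) = ((|A.det|⁻¹ : ℝ) : ℂ) * ∫ w, g w := by
  have hemb : MeasurableEmbedding (Matrix.toLin' A) :=
    (LinearMap.continuous_of_finiteDimensional (Matrix.toLin' A)).measurableEmbedding
      (Matrix.mulVec_injective_of_isUnit ((Matrix.isUnit_iff_isUnit_det A).mpr hA.isUnit))
  have h1 := hemb.integral_map (μ := volume) (fun v : Fin d → ℝ => g (WithLp.toLp 2 v))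
  have h2 := (PiLp.volume_preserving_toLp (Fin d)).integral_comp
    (MeasurableEquiv.toLp 2 _).measurableEmbedding g
  rw [Real.map_matrix_volume_pi_eq_smul_volume_pi hA, integral_smul_measure, h2,
    ENNReal.toReal_ofReal (abs_nonneg _), abs_inv, Complex.real_smul] at h1
  exact h1.symm

theorem norm_gaussian (t : ℝ) (y w : EuclideanSpace ℝ (Fin d)) :
    ‖Complex.exp (-((Real.pi * t : ℝ) : ℂ) * (‖w‖ : ℂ) ^ 2 +
      (-2 * Real.pi * Complex.I) * (inner ℝ y w : ℝ))‖ = Real.exp (-(Real.pi * t) * ‖w‖ ^ 2) := by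
  rw [Complex.norm_exp]
  congr 1
  simp [← Complex.ofReal_pow]

theorem continuous_tsum_gaussian (hA : A.det ≠ 0) {t : ℝ} (ht : 0 < t)
    (y : EuclideanSpace ℝ (Fin d)) :
    Continuous fun v : Fin d → ℝ => ∑' n : Fin d → ℤ,
      Complex.exp (-((Real.pi * t : ℝ) : ℂ) * (‖latticeMap A (v + fun i => (n i : ℝ))‖ : ℂ) ^ 2 +
        (-2 * Real.pi * Complex.I) * (inner ℝ y (latticeMap A (v + fun i => (n i : ℝ))) : ℝ)) := by
  have hM := continuous_latticeMap (A := A)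
  have hpt : 0 < Real.pi * t := mul_pos Real.pi_pos ht
  refine continuous_iff_continuousAt.mpr fun v₀ => ?_
  let R := ‖latticeMap A v₀‖ + 1
  have hopen : IsOpen {v : Fin d → ℝ | ‖latticeMap A v‖ < R} :=
    isOpen_lt hM.norm continuous_const
  refine ContinuousOn.continuousAt (s := {v : Fin d → ℝ | ‖latticeMap A v‖ < R}) ?_
    (hopen.mem_nhds (by simp [R]))
  -- Locally uniform majorant: |An|² ≤ 2(|A(v+n)|² + R²) when |Av| < R, so half of the Gaussian
  -- decay survives at the cost of a factor e^{πtR²}.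
  have hs := (summable_exp_neg_norm_latticePoint_sub_sq hA (half_pos hpt) 0).mul_left
    (Real.exp (Real.pi * t * R ^ 2))
  refine continuousOn_tsum (fun n => Continuous.continuousOn (by fun_prop)) hs fun n v hv => ?_
  rw [norm_gaussian, ← Real.exp_add, Real.exp_le_exp, map_add]
  change _ ≤ _ + -(Real.pi * t / 2) * ‖0 - latticePoint A n‖ ^ 2
  have h1 : ‖latticePoint A n‖ ≤ ‖latticeMap A v + latticePoint A n‖ + ‖latticeMap A v‖ := by
    have := norm_sub_le (latticeMap A v + latticePoint A n) (latticeMap A v)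
    rwa [add_sub_cancel_left] at this
  have h2 : ‖latticePoint A n‖ ≤ ‖latticeMap A v + latticePoint A n‖ + R :=
    h1.trans (by have : ‖latticeMap A v‖ < R := hv; linarith)
  have h3 : ‖latticePoint A n‖ ^ 2 ≤ 2 * (‖latticeMap A v + latticePoint A n‖ ^ 2 + R ^ 2) := by
    have := pow_le_pow_left₀ (norm_nonneg _) h2 2
    nlinarith [sq_nonneg (‖latticeMap A v + latticePoint A n‖ - R)]
  rw [zero_sub, norm_neg]
  change -(Real.pi * t) * ‖latticeMap A v + latticePoint A n‖ ^ 2 ≤ _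
  nlinarith

/-- Poisson summation for a modulated Gaussian on the lattice `A ℤᵈ`. -/
theorem hasSum_dual_gaussian (hA : A.det ≠ 0) {t : ℝ} (ht : 0 < t)
    (x y : EuclideanSpace ℝ (Fin d)) :
    HasSum (fun m : Fin d → ℤ => ((|A.det|⁻¹ * t⁻¹ ^ (d / 2 : ℝ) : ℝ) : ℂ) *
        (Complex.exp (-2 * Real.pi * Complex.I * (inner ℝ (y + latticePoint (A⁻¹)ᵀ m) x : ℝ)) *
          Real.exp (-Real.pi * ‖y + latticePoint (A⁻¹)ᵀ m‖ ^ 2 * t⁻¹)))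
      (∑' n : Fin d → ℤ, Complex.exp (-2 * Real.pi * Complex.I * (inner ℝ y (latticePoint A n) : ℝ)) *
          Real.exp (-Real.pi * ‖x - latticePoint A n‖ ^ 2 * t)) := by
  have hpt : 0 < Real.pi * t := mul_pos Real.pi_pos ht
  let g : EuclideanSpace ℝ (Fin d) → EuclideanSpace ℝ (Fin d) → ℂ := fun y w =>
    Complex.exp (-((Real.pi * t : ℝ) : ℂ) * (‖w‖ : ℂ) ^ 2 +
      (-2 * Real.pi * Complex.I) * (inner ℝ y w : ℝ))
  -- With Av = -x, the translate A(v+n) is An - x, whose norm is |x - An|.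
  obtain ⟨v, hv⟩ : ∃ v, latticeMap A v = -x :=
    (LinearMap.injective_iff_surjective_of_finrank_eq_finrank (by simp)).mp
      (latticeMap_injective hA) (-x)
  have hi : Integrable fun v => g y (latticeMap A v) := by
    refine integrable_comp_latticeMap hA (g := g y) ?_
    exact GaussianFourier.integrable_cexp_neg_mul_sq_norm_add (by simpa using hpt) _ _
  have hsum : ∀ v, Summable fun n : Fin d → ℤ => g y (latticeMap A (v + fun i => (n i : ℝ))) := by
    intro v
    refine Summable.of_norm ?_
    simp only [g, norm_gaussian]
    refine (summable_exp_neg_norm_latticePoint_sub_sq hA hpt (-latticeMap A v)).congr fun n => ?_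
    rw [map_add, ← norm_neg, neg_sub, sub_neg_eq_add, add_comm]
    rfl
  have hcoef : ∀ m : Fin d → ℤ,
      ∫ v : Fin d → ℝ, Complex.exp (-(2 * Real.pi * Complex.I * (∑ i, (m i : ℝ) * v i : ℝ))) *
        g y (latticeMap A v) = ((|A.det|⁻¹ * t⁻¹ ^ (d / 2 : ℝ) : ℝ) : ℂ) *
          Real.exp (-Real.pi * ‖y + latticePoint (A⁻¹)ᵀ m‖ ^ 2 * t⁻¹) := by
    intro m
    -- Since m·v = (A⁻ᵀm)·(Av), the m-th character only shifts the frequency y by a reciprocal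
    -- lattice vector.
    have h1 : ∀ v : Fin d → ℝ, Complex.exp (-(2 * Real.pi * Complex.I * (∑ i, (m i : ℝ) * v i : ℝ))) *
        g y (latticeMap A v) = g (y + latticePoint (A⁻¹)ᵀ m) (latticeMap A v) := by
      intro v
      simp only [g]
      rw [← Complex.exp_add, inner_add_left, latticePoint, inner_latticeMap hA]
      congr 1
      push_cast
      ring
    simp only [h1]
    rw [integral_comp_latticeMap hA]
    simp only [g]
    rw [GaussianFourier.integral_cexp_neg_mul_sq_norm_add (by simpa using hpt)]
    rw [Complex.ofReal_mul |A.det|⁻¹, mul_assoc, mul_assoc, Complex.ofReal_cpow (inv_nonneg.mpr ht.le)]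
    congr 2
    · rw [finrank_euclideanSpace_fin]
      push_cast
      congr 1
      field_simp
    · rw [Complex.ofReal_exp]
      congr 1
      push_cast
      have : (t : ℂ) ≠ 0 := by exact_mod_cast ht.ne'
      have : (Real.pi : ℂ) ≠ 0 := by exact_mod_cast Real.pi_ne_zero
      field_simp
      rw [Complex.I_sq]
      ring
  have hs : Summable fun m : Fin d → ℤ => ((|A.det|⁻¹ * t⁻¹ ^ (d / 2 : ℝ) : ℝ) : ℂ) *
      ((Real.exp (-Real.pi * ‖y + latticePoint (A⁻¹)ᵀ m‖ ^ 2 * t⁻¹) : ℝ) : ℂ) := by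
    refine Summable.mul_left _ (Complex.summable_ofReal.mpr ?_)
    refine (summable_exp_neg_norm_latticePoint_sub_sq (det_transpose_inv_ne_zero hA)
      (mul_pos Real.pi_pos (inv_pos.mpr ht)) (-y)).congr fun m => ?_
    congr 1
    rw [← norm_neg, neg_sub, sub_neg_eq_add, add_comm]
    ring
  have key := hasSum_fourier_of_hasSum_translates hi (continuous_tsum_gaussian hA ht y)
    (fun v => (hsum v).hasSum) (fun m => (hcoef m).symm) hs v
  -- The factor e^{-2πi y·x} turns the phase y·(An - x) into y·An, and on the dual side completes
  -- (A⁻ᵀm)·x to (y + A⁻ᵀm)·x.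
  have key2 := key.mul_left (Complex.exp (-2 * Real.pi * Complex.I * (inner ℝ y x : ℝ)))
  rw [← tsum_mul_left] at key2
  convert! key2 using 1
  · funext m
    have : inner ℝ (latticePoint (A⁻¹)ᵀ m) x = -∑ i, (m i : ℝ) * v i := by
      rw [← inner_latticeMap hA, hv, inner_neg_right, neg_neg]
      rfl
    rw [inner_add_left, this]
    push_cast
    rw [mul_add, Complex.exp_add]
    ring_nf
  · refine tsum_congr fun n => ?_
    rw [map_add, hv, ← Complex.exp_add, Complex.ofReal_exp, ← Complex.exp_add]
    change _ = Complex.exp (_ + (-((Real.pi * t : ℝ) : ℂ) * (‖-x + latticePoint A n‖ : ℂ) ^ 2 +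
      (-2 * Real.pi * Complex.I) * (inner ℝ y (-x + latticePoint A n) : ℝ)))
    congr 1
    rw [inner_add_right, inner_neg_right, ← norm_neg (-x + latticePoint A n), neg_add, neg_neg,
      ← sub_eq_add_neg]
    push_cast
    ring

end gaussian

/-! ### Theta series and their functional equation -/

noncomputable section

/-- The theta series `∑_{z ∈ Λ, z ≠ x} e^{-2πi y·z} e^{-π |x - z|² t}`. -/
def puncturedTheta {d : ℕ} (A : Matrix (Fin d) (Fin d) ℝ) (x y : EuclideanSpace ℝ (Fin d))
    (t : ℝ) : ℂ :=
  ∑' n, if ‖x - latticePoint A n‖ = 0 then 0 else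
    Complex.exp (-2 * Real.pi * Complex.I * (inner ℝ y (latticePoint A n) : ℝ)) *
      Real.exp (-Real.pi * ‖x - latticePoint A n‖ ^ 2 * t)

open Classical in
/-- The term `z = x` of the theta series, which is present if `x ∈ Λ`. -/
def thetaConstant {d : ℕ} (A : Matrix (Fin d) (Fin d) ℝ) (x y : EuclideanSpace ℝ (Fin d)) : ℂ :=
  if x ∈ lattice A then Complex.exp (-2 * Real.pi * Complex.I * (inner ℝ y x : ℝ)) else 0

/-- The theta series `∑_{z ∈ Λ} e^{-2πi y·z} e^{-π |x - z|² t}`. -/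
def epsteinTheta {d : ℕ} (A : Matrix (Fin d) (Fin d) ℝ) (x y : EuclideanSpace ℝ (Fin d))
    (t : ℝ) : ℂ :=
  thetaConstant A x y + puncturedTheta A x y t

section theta

variable {d : ℕ} {A : Matrix (Fin d) (Fin d) ℝ}

theorem norm_exp_neg_two_pi_I_mul (r : ℝ) :
    ‖Complex.exp (-2 * Real.pi * Complex.I * (r : ℝ))‖ = 1 := by
  rw [Complex.norm_exp]
  simp

theorem norm_puncturedTheta_term_le (x y : EuclideanSpace ℝ (Fin d)) (t : ℝ) (n : Fin d → ℤ) :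
    ‖(if ‖x - latticePoint A n‖ = 0 then 0 else
      Complex.exp (-2 * Real.pi * Complex.I * (inner ℝ y (latticePoint A n) : ℝ)) *
        Real.exp (-Real.pi * ‖x - latticePoint A n‖ ^ 2 * t) : ℂ)‖ ≤
      Real.exp (-(Real.pi * t) * ‖x - latticePoint A n‖ ^ 2) := by
  split_ifs
  · simpa using (Real.exp_pos _).le
  · rw [norm_mul, norm_exp_neg_two_pi_I_mul, one_mul, Complex.norm_real,
      Real.norm_of_nonneg (Real.exp_pos _).le]
    exact le_of_eq (congrArg _ (by ring))

theorem hasSum_puncturedTheta (hA : A.det ≠ 0) (x y : EuclideanSpace ℝ (Fin d)) {t : ℝ}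
    (ht : 0 < t) :
    HasSum (fun n => if ‖x - latticePoint A n‖ = 0 then 0 else
      Complex.exp (-2 * Real.pi * Complex.I * (inner ℝ y (latticePoint A n) : ℝ)) *
        Real.exp (-Real.pi * ‖x - latticePoint A n‖ ^ 2 * t)) (puncturedTheta A x y t) :=
  (Summable.of_norm_bounded
    (summable_exp_neg_norm_latticePoint_sub_sq hA (mul_pos Real.pi_pos ht) x)
    fun n => norm_puncturedTheta_term_le x y t n).hasSum

/-- At most one lattice point equals x, and its Gaussian factor is 1 for every t; its contribution
is therefore the constant `thetaConstant`. -/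
theorem hasSum_epsteinTheta (hA : A.det ≠ 0) (x y : EuclideanSpace ℝ (Fin d)) {t : ℝ}
    (ht : 0 < t) :
    HasSum (fun n =>
      Complex.exp (-2 * Real.pi * Complex.I * (inner ℝ y (latticePoint A n) : ℝ)) *
        Real.exp (-Real.pi * ‖x - latticePoint A n‖ ^ 2 * t)) (epsteinTheta A x y t) := by
  classical
  have h : HasSum (fun n => if ‖x - latticePoint A n‖ = 0 then
      Complex.exp (-2 * Real.pi * Complex.I * (inner ℝ y (latticePoint A n) : ℝ)) else 0)
      (thetaConstant A x y) := by
    rw [thetaConstant]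
    split_ifs with hx
    · obtain ⟨m, rfl⟩ := mem_lattice_iff.mp hx
      convert hasSum_ite_eq m
        (Complex.exp (-2 * Real.pi * Complex.I * (inner ℝ y (latticePoint A m) : ℝ))) using 1
      funext n
      have : ‖latticePoint A m - latticePoint A n‖ = 0 ↔ n = m := by
        rw [norm_eq_zero, sub_eq_zero, (latticePoint_injective hA).eq_iff, eq_comm]
      by_cases hn : n = m <;> simp [this, hn]
    · convert hasSum_zero using 2 with n
      refine if_neg fun h0 => hx ?_
      rw [norm_eq_zero, sub_eq_zero] at h0
      exact mem_lattice_iff.mpr ⟨n, h0.symm⟩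
  refine (h.add (hasSum_puncturedTheta hA x y ht)).congr_fun fun n => ?_
  by_cases hn : ‖x - latticePoint A n‖ = 0 <;> simp [hn]

theorem continuousOn_epsteinTheta (hA : A.det ≠ 0) (x y : EuclideanSpace ℝ (Fin d)) :
    ContinuousOn (epsteinTheta A x y) (Set.Ioi 0) := by
  intro t (ht : 0 < t)
  refine (continuousAt_const.add ?_).continuousWithinAt
  refine ContinuousOn.continuousAt (s := Set.Ioi (t / 2)) ?_ (Ioi_mem_nhds (half_lt_self ht))
  refine continuousOn_tsum (fun n => ?_)
    (summable_exp_neg_norm_latticePoint_sub_sq hA (mul_pos Real.pi_pos (half_pos ht)) x)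
    fun n s hs => (norm_puncturedTheta_term_le x y s n).trans ?_
  · split_ifs <;> fun_prop
  · have hs' : t / 2 < s := hs
    rw [Real.exp_le_exp]
    have := mul_le_mul_of_nonneg_left hs'.le Real.pi_pos.le
    exact mul_le_mul_of_nonneg_right (neg_le_neg this) (sq_nonneg _)

theorem epsteinTheta_sub_isBigO (hA : A.det ≠ 0) (x y : EuclideanSpace ℝ (Fin d)) (r : ℝ) :
    (fun t => epsteinTheta A x y t - thetaConstant A x y) =O[atTop] fun t : ℝ => t ^ r := by
  -- The summand d + 1 makes ∑ |x - z|^{-2N} converge; the summand ⌈-r⌉₊ makes t^{-N} ≤ t^r for t ≥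
  -- 1.
  let N := d + 1 + ⌈-r⌉₊
  have hN : -r ≤ N := (Nat.le_ceil (-r)).trans (Nat.cast_le.mpr (Nat.le_add_left _ _))
  have hNd : (d : ℝ) + 1 ≤ N := by
    simp only [N]
    push_cast
    exact le_add_of_nonneg_right (Nat.cast_nonneg _)
  have hs := summable_norm_latticePoint_sub_rpow hA (r := -(2 * N : ℝ)) (by linarith) x
  let K := (N.factorial : ℝ) / Real.pi ^ N * ∑' n, ‖x - latticePoint A n‖ ^ (-(2 * N : ℝ))
  refine Asymptotics.IsBigO.of_bound K ?_
  filter_upwards [eventually_ge_atTop 1] with t ht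
  have ht0 : 0 < t := one_pos.trans_le ht
  rw [epsteinTheta, add_sub_cancel_left]
  have hb : ∀ n, ‖(if ‖x - latticePoint A n‖ = 0 then 0 else
      Complex.exp (-2 * Real.pi * Complex.I * (inner ℝ y (latticePoint A n) : ℝ)) *
        Real.exp (-Real.pi * ‖x - latticePoint A n‖ ^ 2 * t) : ℂ)‖ ≤
      (N.factorial : ℝ) / (Real.pi * t) ^ N * ‖x - latticePoint A n‖ ^ (-(2 * N : ℝ)) := by
    intro n
    by_cases hn : ‖x - latticePoint A n‖ = 0
    · rw [if_pos hn, norm_zero]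
      positivity
    · refine (norm_puncturedTheta_term_le x y t n).trans ?_
      simpa using exp_neg_mul_sq_le (mul_pos Real.pi_pos ht0) hn N
  refine (tsum_of_norm_bounded (hs.mul_left _).hasSum hb).trans ?_
  rw [tsum_mul_left, Real.norm_of_nonneg (Real.rpow_nonneg ht0.le _)]
  have h1 : t ^ (-(N : ℝ)) ≤ t ^ r := Real.rpow_le_rpow_of_exponent_le ht (by linarith)
  calc _ = K * t ^ (-(N : ℝ)) := by
        simp only [K]
        rw [Real.rpow_neg ht0.le, Real.rpow_natCast, mul_pow]
        field_simp
    _ ≤ _ := mul_le_mul_of_nonneg_left h1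
        (mul_nonneg (by positivity) (tsum_nonneg fun n => by positivity))

/-- The functional equation of the theta series. -/
theorem epsteinTheta_one_div (hA : A.det ≠ 0) (x y : EuclideanSpace ℝ (Fin d)) {t : ℝ}
    (ht : 0 < t) :
    epsteinTheta A x y (1 / t) = ((t ^ (d / 2 : ℝ) : ℝ) : ℂ) *
      ((((|A.det|⁻¹ : ℝ) : ℂ) * Complex.exp (-2 * Real.pi * Complex.I * (inner ℝ y x : ℝ))) *
        epsteinTheta (A⁻¹)ᵀ (-y) x t) := by
  have h1 := hasSum_dual_gaussian hA (one_div_pos.mpr ht) x y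
  rw [(hasSum_epsteinTheta hA x y (one_div_pos.mpr ht)).tsum_eq] at h1
  have h2 := (hasSum_epsteinTheta (det_transpose_inv_ne_zero hA) (-y) x ht).mul_left
    (((t ^ (d / 2 : ℝ) : ℝ) : ℂ) *
      (((|A.det|⁻¹ : ℝ) : ℂ) * Complex.exp (-2 * Real.pi * Complex.I * (inner ℝ y x : ℝ))))
  rw [← mul_assoc]
  -- Termwise, |y + w| = |-y - w| for w = A⁻ᵀm, and the phase (y + w)·x splits into y·x, which goes
  -- into the prefactor, and the phase x·w of the dual series.
  refine h1.unique (h2.congr_fun fun m => ?_)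
  rw [one_div, inv_inv, inner_add_left, ← norm_neg (-y - _), neg_sub, sub_neg_eq_add, add_comm y,
    real_inner_comm (latticePoint _ m)]
  push_cast
  rw [mul_add, Complex.exp_add]
  ring

/-- The theta series of `Λ` and of `Λ*` as a pair related by a functional equation. -/
def epsteinFEPair (hd : 0 < d) (hA : A.det ≠ 0) (x y : EuclideanSpace ℝ (Fin d)) :
    WeakFEPair ℂ where
  f := epsteinTheta A x y
  g t := (((|A.det|⁻¹ : ℝ) : ℂ) * Complex.exp (-2 * Real.pi * Complex.I * (inner ℝ y x : ℝ))) *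
    epsteinTheta (A⁻¹)ᵀ (-y) x t
  k := d / 2
  ε := 1
  f₀ := thetaConstant A x y
  g₀ := (((|A.det|⁻¹ : ℝ) : ℂ) * Complex.exp (-2 * Real.pi * Complex.I * (inner ℝ y x : ℝ))) *
    thetaConstant (A⁻¹)ᵀ (-y) x
  hf_int := (continuousOn_epsteinTheta hA x y).locallyIntegrableOn measurableSet_Ioi
  hg_int := (continuousOn_const.mul
    (continuousOn_epsteinTheta (det_transpose_inv_ne_zero hA) (-y) x)).locallyIntegrableOn
      measurableSet_Ioi
  -- The weight d/2 has to be positive, which excludes d = 0.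
  hk := by positivity
  hε := one_ne_zero
  h_feq t ht := by rw [epsteinTheta_one_div hA x y ht, one_mul, smul_eq_mul]
  hf_top := epsteinTheta_sub_isBigO hA x y
  hg_top r := by
    simp only [← mul_sub]
    exact (epsteinTheta_sub_isBigO (det_transpose_inv_ne_zero hA) (-y) x r).const_mul_left _

end theta

/-! ### Meromorphic continuation by the Mellin transform -/

section continuation

variable {d : ℕ} {A : Matrix (Fin d) (Fin d) ℝ}

theorem summable_inv_norm_latticePoint_sub_rpow (hA : A.det ≠ 0) (x : EuclideanSpace ℝ (Fin d))
    {r : ℝ} (hr : d < r) : Summable fun n => 1 / ‖x - latticePoint A n‖ ^ r := by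
  refine (summable_norm_latticePoint_sub_rpow hA (neg_lt_neg hr) x).congr fun n => ?_
  rw [Real.rpow_neg (norm_nonneg _), one_div]

/-- A sum over the punctured lattice as a sum over the integer coordinates. -/
theorem hasSum_lattice_diff_singleton_iff (hA : A.det ≠ 0) (x y : EuclideanSpace ℝ (Fin d)) {ν : ℂ}
    (hν : ν ≠ 0) {c : ℂ} :
    HasSum (fun z : ↥(lattice A \ {x}) => epsteinSummand x y ν z) c ↔
      HasSum (fun n => epsteinSummand x y ν (latticePoint A n)) c := by
  change HasSum (epsteinSummand x y ν ∘ Subtype.val) c ↔ _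
  rw [hasSum_subtype_iff_indicator,
    ← (latticePoint_injective hA).hasSum_iff]
  · refine iff_of_eq (congrArg (fun g => HasSum g c) ?_)
    funext n
    simp only [Function.comp_apply, Set.indicator]
    split_ifs with h
    · rfl
    -- The term z = x, absent from the punctured sum, vanishes here: 0^ν = 0 for ν ≠ 0, and division
    -- by 0 gives 0.
    · have : latticePoint A n = x := by
        by_contra hne
        exact h ⟨mem_lattice_iff.mpr ⟨n, rfl⟩, hne⟩
      simp [epsteinSummand, this, Complex.zero_cpow hν]
  · intro z hz
    refine Set.indicator_of_notMem (fun h => hz ?_) _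
    rw [← lattice_eq_range]
    exact h.1

/-- The explicit continuation of the lattice sum, which need not have normal form at `ν = d`. -/
def epsteinContinuation (hd : 0 < d) (hA : A.det ≠ 0) (x y : EuclideanSpace ℝ (Fin d)) (ν : ℂ) :
    ℂ :=
  (Real.pi : ℂ) ^ (ν / 2) * ((epsteinFEPair hd hA x y).Λ₀ (ν / 2) * (Complex.Gamma (ν / 2))⁻¹ -
    thetaConstant A x y * (Complex.Gamma (ν / 2 + 1))⁻¹ -
    (epsteinFEPair hd hA x y).g₀ * ((d / 2 : ℂ) - ν / 2)⁻¹ * (Complex.Gamma (ν / 2))⁻¹)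

/-- With s = ν/2, Λ(s) = Λ₀(s) - f₀/s - g₀/(d/2 - s). Dividing by Γ(s) and writing sΓ(s) = Γ(s+1)
absorbs the pole at s = 0, which explains the shape of `epsteinContinuation`. -/
theorem epsteinContinuation_eq (hd : 0 < d) (hA : A.det ≠ 0) (x y : EuclideanSpace ℝ (Fin d))
    {ν : ℂ} (hν : 0 < ν.re) :
    epsteinContinuation hd hA x y ν = (Complex.Gammaℝ ν)⁻¹ * (epsteinFEPair hd hA x y).Λ (ν / 2) := by
  have hν0 : ν / 2 ≠ 0 := by
    intro h
    have : ν = 0 := by simpa using h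
    simp [this] at hν
  have h1 := (epsteinFEPair hd hA x y).Λ₀_eq (ν / 2)
  rw [epsteinContinuation, h1, Complex.Gammaℝ_def, Complex.Gamma_add_one _ hν0, mul_inv, neg_div,
    Complex.cpow_neg]
  have hf0 : (epsteinFEPair hd hA x y).f₀ = thetaConstant A x y := rfl
  have hk : (((epsteinFEPair hd hA x y).k : ℝ) : ℂ) = d / 2 := by
    simp [epsteinFEPair]
  have hε : (epsteinFEPair hd hA x y).ε = 1 := rfl
  rw [hf0, hk, hε, smul_eq_mul, smul_eq_mul, mul_inv, inv_inv]
  ring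

/-- Each Gaussian e^{-πr²t} has Mellin transform π^{-ν/2} Γ(ν/2) r^{-ν} at ν/2, and absolute
convergence for Re ν > d permits termwise integration. -/
theorem hasSum_epsteinContinuation (hd : 0 < d) (hA : A.det ≠ 0) (x y : EuclideanSpace ℝ (Fin d))
    {ν : ℂ} (hν : (d : ℝ) < ν.re) :
    HasSum (fun z : ↥(lattice A \ {x}) => epsteinSummand x y ν z)
      (epsteinContinuation hd hA x y ν) := by
  have hν0 : 0 < ν.re := (Nat.cast_nonneg d).trans_lt hν
  rw [hasSum_lattice_diff_singleton_iff hA x y (by rintro rfl; simp at hν0),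
    epsteinContinuation_eq hd hA x y hν0]
  have h1 := hasSum_mellin_pi_mul_sq (r := fun n => ‖x - latticePoint A n‖) hν0
    (fun t ht => hasSum_puncturedTheta hA x y ht) (by
      simp only [norm_exp_neg_two_pi_I_mul, abs_norm]
      exact summable_inv_norm_latticePoint_sub_rpow hA x hν)
  -- Re(ν/2) > d/2 is the range where Λ is the Mellin transform of θ minus its constant, that is, of
  -- the punctured theta series.
  have h2 := ((epsteinFEPair hd hA x y).hasMellin (s := ν / 2) (by
    change (d / 2 : ℝ) < _
    rw [Complex.div_ofNat_re]
    linarith)).2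
  have h3 : mellin (puncturedTheta A x y) (ν / 2) = (epsteinFEPair hd hA x y).Λ (ν / 2) := by
    rw [← h2]
    congr 1
    funext t
    simp [epsteinFEPair, epsteinTheta]
  rw [h3] at h1
  refine (h1.mul_left (Complex.Gammaℝ ν)⁻¹).congr_fun fun n => ?_
  have hG := Complex.Gammaℝ_ne_zero_of_re_pos hν0
  rw [epsteinSummand, abs_norm]
  field_simp

theorem analyticAt_inv_Gamma_comp {g : ℂ → ℂ} (hg : Differentiable ℂ g) (ν : ℂ) :
    AnalyticAt ℂ (fun ν => (Complex.Gamma (g ν))⁻¹) ν :=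
  (Complex.differentiable_one_div_Gamma.comp hg).analyticAt ν

/-- 1/Γ is entire, so the only non-entire factor is 1/(d/2 - ν/2). Its coefficient g₀ vanishes when
-y, equivalently y, is outside Λ*. -/
theorem meromorphicAt_epsteinContinuation (hd : 0 < d) (hA : A.det ≠ 0)
    (x y : EuclideanSpace ℝ (Fin d)) (ν : ℂ) :
    MeromorphicAt (epsteinContinuation hd hA x y) ν ∧
      ((y ∈ reciprocalLattice A → ν ≠ d) → AnalyticAt ℂ (epsteinContinuation hd hA x y) ν) := by
  have h2 : Differentiable ℂ fun ν : ℂ => ν / 2 := by fun_prop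
  have hpi : AnalyticAt ℂ (fun ν : ℂ => (Real.pi : ℂ) ^ (ν / 2)) ν := by
    refine Differentiable.analyticAt (fun w => ?_) ν
    exact (h2 w).const_cpow (Or.inl (by exact_mod_cast Real.pi_ne_zero))
  have hL : AnalyticAt ℂ (fun ν : ℂ => (epsteinFEPair hd hA x y).Λ₀ (ν / 2)) ν :=
    ((epsteinFEPair hd hA x y).differentiable_Λ₀.comp h2).analyticAt ν
  have hG := analyticAt_inv_Gamma_comp h2 ν
  have hG1 := analyticAt_inv_Gamma_comp (h2.add_const 1) ν
  have hlin : AnalyticAt ℂ (fun ν : ℂ => (d / 2 : ℂ) - ν / 2) ν :=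
    Differentiable.analyticAt (by fun_prop) ν
  have hreg := (hL.mul hG).sub ((analyticAt_const (v := thetaConstant A x y)).mul hG1)
  constructor
  · exact hpi.meromorphicAt.mul (hreg.meromorphicAt.sub
      (((MeromorphicAt.const _ ν).mul hlin.meromorphicAt.inv).mul hG.meromorphicAt))
  · intro h
    refine hpi.mul (hreg.sub ?_)
    by_cases hy : y ∈ reciprocalLattice A
    · refine (analyticAt_const.mul (hlin.inv ?_)).mul hG
      intro h0
      exact h hy (by linear_combination (-2 : ℂ) * h0)
    · have hg : (epsteinFEPair hd hA x y).g₀ = 0 := by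
        have hy' : -y ∉ lattice (A⁻¹)ᵀ := by
          intro h0
          obtain ⟨n, hn⟩ := mem_lattice_iff.mp h0
          exact hy (mem_lattice_iff.mpr ⟨-n, by rw [latticePoint_neg, hn, neg_neg]⟩)
        simp [epsteinFEPair, thetaConstant, hy']
      simp only [hg, zero_mul]
      exact analyticAt_const

/-- The lattice sum has a meromorphic continuation to `ℂ`, which is holomorphic except possibly for
a pole at `d` if `y` is in the reciprocal lattice. -/
theorem exists_isEpsteinContinuation (hA : A.det ≠ 0) (x y : EuclideanSpace ℝ (Fin d)) :
    ∃ f, IsEpsteinContinuation (lattice A) x y f ∧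
      ∀ ν : ℂ, (y ∈ reciprocalLattice A → ν ≠ d) → AnalyticAt ℂ f ν := by
  -- In dimension 0 the space is the single point x, so the punctured lattice is empty and the sum
  -- is 0.
  rcases Nat.eq_zero_or_pos d with rfl | hd
  · refine ⟨fun _ => 0, ⟨fun ν _ => analyticAt_const.meromorphicNFAt, fun ν _ => ?_⟩,
      fun ν _ => analyticAt_const⟩
    have : IsEmpty ↥(lattice A \ {x}) := ⟨fun z => z.2.2 (Subsingleton.elim _ _)⟩
    exact hasSum_empty
  · have hm : MeromorphicOn (epsteinContinuation hd hA x y) Set.univ := fun ν _ =>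
      (meromorphicAt_epsteinContinuation hd hA x y ν).1
    -- An analytic function is already in normal form, so normalizing can change the value only at ν
    -- = d with y ∈ Λ*.
    have hloc : ∀ ν : ℂ, (y ∈ reciprocalLattice A → ν ≠ d) →
        toMeromorphicNFOn (epsteinContinuation hd hA x y) Set.univ =ᶠ[nhds ν]
          epsteinContinuation hd hA x y := by
      intro ν hν
      have h1 := toMeromorphicNFOn_eq_toMeromorphicNFAt_on_nhds hm (Set.mem_univ ν)
      rwa [toMeromorphicNFAt_eq_self.mpr
        ((meromorphicAt_epsteinContinuation hd hA x y ν).2 hν).meromorphicNFAt] at h1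
    refine ⟨toMeromorphicNFOn (epsteinContinuation hd hA x y) Set.univ,
      ⟨meromorphicNFOn_toMeromorphicNFOn _ _, fun ν hν => ?_⟩, fun ν hν => ?_⟩
    · rw [(hloc ν fun _ h => by simp [h] at hν).eq_of_nhds]
      exact hasSum_epsteinContinuation hd hA x y hν
    · exact (analyticAt_congr (hloc ν hν)).mpr ((meromorphicAt_epsteinContinuation hd hA x y ν).2 hν)

theorem isEpsteinContinuation_epsteinZeta (hA : A.det ≠ 0) (x y : EuclideanSpace ℝ (Fin d)) :
    IsEpsteinContinuation (lattice A) x y (epsteinZeta (lattice A) x y) := by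
  obtain ⟨f, hf, -⟩ := exists_isEpsteinContinuation hA x y
  have h : ∃ f, IsEpsteinContinuation (lattice A) x y f := ⟨f, hf⟩
  rw [epsteinZeta, dif_pos h]
  exact h.choose_spec

theorem IsEpsteinContinuation.eq_epsteinZeta (hA : A.det ≠ 0) {x y : EuclideanSpace ℝ (Fin d)}
    {f : ℂ → ℂ} (hf : IsEpsteinContinuation (lattice A) x y f) :
    epsteinZeta (lattice A) x y = f :=
  (isEpsteinContinuation_epsteinZeta hA x y).unique hf

end continuation

/-! ### Symmetries by reindexing the lattice sum -/

section symmetry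

variable {d : ℕ} {A : Matrix (Fin d) (Fin d) ℝ} {x y x' y' : EuclideanSpace ℝ (Fin d)}

/-- Two lattice sums whose summands correspond under a bijection of the punctured lattices, up to an
entire factor without zeros, have continuations that differ by this factor. -/
theorem IsEpsteinContinuation.mul_of_equiv {Λ Λ' : Set (EuclideanSpace ℝ (Fin d))} {f g : ℂ → ℂ}
    (hf : IsEpsteinContinuation Λ' x' y' f) (hg : Differentiable ℂ g) (hg0 : ∀ ν, g ν ≠ 0)
    (e : ↥(Λ \ {x}) ≃ ↥(Λ' \ {x'}))
    (he : ∀ (z : ↥(Λ \ {x})) (ν : ℂ), epsteinSummand x y ν z = g ν * epsteinSummand x' y' ν (e z)) :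
    IsEpsteinContinuation Λ x y (g * f) := by
  -- A zero-free entire factor preserves normal form, so the identity holds at every ν, poles
  -- included.
  refine ⟨(meromorphicNFOn_mul_iff_right_of_analyticOnNhd (fun ν _ => hg.analyticAt ν)
    fun ν _ => hg0 ν).mpr hf.1, fun ν hν => ?_⟩
  have := (e.hasSum_iff.mpr (hf.2 ν hν)).mul_left (g ν)
  exact this.congr_fun fun z => he z ν

theorem neg_mem_lattice {z : EuclideanSpace ℝ (Fin d)} (hz : z ∈ lattice A) : -z ∈ lattice A := by
  obtain ⟨n, rfl⟩ := mem_lattice_iff.mp hz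
  exact mem_lattice_iff.mpr ⟨-n, latticePoint_neg n⟩

theorem add_mem_lattice {z w : EuclideanSpace ℝ (Fin d)} (hz : z ∈ lattice A)
    (hw : w ∈ lattice A) : z + w ∈ lattice A := by
  obtain ⟨m, rfl⟩ := mem_lattice_iff.mp hz
  obtain ⟨n, rfl⟩ := mem_lattice_iff.mp hw
  exact mem_lattice_iff.mpr ⟨m + n, latticePoint_add m n⟩

theorem exists_int_inner_eq (hA : A.det ≠ 0) {u v : EuclideanSpace ℝ (Fin d)}
    (hv : v ∈ reciprocalLattice A) (hu : u ∈ lattice A) : ∃ k : ℤ, inner ℝ v u = (k : ℝ) := by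
  obtain ⟨m, rfl⟩ := mem_lattice_iff.mp hv
  obtain ⟨n, rfl⟩ := mem_lattice_iff.mp hu
  refine ⟨∑ i, m i * n i, ?_⟩
  rw [latticePoint, latticePoint, inner_latticeMap hA]
  push_cast
  rfl

theorem smul_lattice (s : ℝ) : s • lattice A = lattice (s • A) := by
  ext z
  rw [Set.mem_smul_set]
  simp only [mem_lattice_iff]
  have h : ∀ n, latticePoint (s • A) n = s • latticePoint A n := by
    intro n
    simp only [latticePoint, latticeMap_apply, Matrix.smul_mulVec, WithLp.toLp_smul]
  simp [h]

/-- Under z ↦ -z, |-x - z| = |x - (-z)| and y·z = (-y)·(-z). -/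
theorem epsteinZeta_neg_left (hA : A.det ≠ 0) (x y : EuclideanSpace ℝ (Fin d)) :
    epsteinZeta (lattice A) (-x) y = epsteinZeta (lattice A) x (-y) := by
  refine IsEpsteinContinuation.eq_epsteinZeta hA ?_
  have e : ∀ z, z ∈ lattice A \ {-x} ↔ Equiv.neg _ z ∈ lattice A \ {x} := by
    intro z
    simp only [Set.mem_sdiff, Set.mem_singleton_iff, Equiv.neg_apply]
    refine and_congr ⟨neg_mem_lattice, fun h => neg_neg z ▸ neg_mem_lattice h⟩ ?_
    rw [neg_eq_iff_eq_neg]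
  have := (isEpsteinContinuation_epsteinZeta hA x (-y)).mul_of_equiv (g := fun _ => 1)
    (x := -x) (y := y) (differentiable_const _) (fun _ => one_ne_zero)
    ((Equiv.neg _).subtypeEquiv e) fun z ν => ?_
  · simpa [funext_iff, Pi.mul_def] using this
  · change _ = 1 * epsteinSummand x (-y) ν (-(z : EuclideanSpace ℝ (Fin d)))
    rw [one_mul, epsteinSummand, epsteinSummand, inner_neg_neg, ← norm_neg (-x - _)]
    congr 4
    abel_nf

/-- Under z ↦ z - u, the distance |x + u - z| is |x - (z - u)|. Since v·z is an integer for z ∈ Λ,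
the phase changes only by e^{-2πi y·u}. -/
theorem epsteinZeta_add_add (hA : A.det ≠ 0) (x y : EuclideanSpace ℝ (Fin d))
    {u v : EuclideanSpace ℝ (Fin d)} (hu : u ∈ lattice A) (hv : v ∈ reciprocalLattice A) :
    epsteinZeta (lattice A) (x + u) (y + v) =
      (fun _ => Complex.exp (-2 * Real.pi * Complex.I * (inner ℝ y u : ℝ))) *
        epsteinZeta (lattice A) x y := by
  refine IsEpsteinContinuation.eq_epsteinZeta hA ?_
  have e : ∀ z, z ∈ lattice A \ {x + u} ↔ Equiv.subRight u z ∈ lattice A \ {x} := by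
    intro z
    simp only [Set.mem_sdiff, Set.mem_singleton_iff, Equiv.subRight_apply]
    refine and_congr ⟨fun h => sub_eq_add_neg z u ▸ add_mem_lattice h (neg_mem_lattice hu),
      fun h => sub_add_cancel z u ▸ add_mem_lattice h hu⟩ ?_
    rw [sub_eq_iff_eq_add]
  refine (isEpsteinContinuation_epsteinZeta hA x y).mul_of_equiv (differentiable_const _)
    (fun _ => Complex.exp_ne_zero _) ((Equiv.subRight u).subtypeEquiv e) fun z ν => ?_
  change _ = _ * epsteinSummand x y ν ((z : EuclideanSpace ℝ (Fin d)) - u)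
  obtain ⟨k, hk⟩ := exists_int_inner_eq hA hv z.2.1
  rw [epsteinSummand, epsteinSummand, ← mul_div_assoc, ← Complex.exp_add]
  congr 1
  · rw [Complex.exp_eq_exp_iff_exists_int]
    refine ⟨-k, ?_⟩
    rw [inner_add_left, hk, inner_sub_right]
    push_cast
    ring
  · congr 3
    abel_nf

/-- Under z ↦ sz, the pairing (y/s)·(sz) = y·z is unchanged and the distance is multiplied by |s|.
The factor |s|^ν is entire without zeros because s ≠ 0. -/
theorem epsteinZeta_eq_smul (hA : A.det ≠ 0) (x y : EuclideanSpace ℝ (Fin d)) {s : ℝ}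
    (hs : s ≠ 0) :
    epsteinZeta (lattice A) x y =
      (fun ν : ℂ => ((|s| : ℝ) : ℂ) ^ ν) * epsteinZeta (s • lattice A) (s • x) (s⁻¹ • y) := by
  refine IsEpsteinContinuation.eq_epsteinZeta hA ?_
  have hsA : (s • A).det ≠ 0 := by
    rw [Matrix.det_smul]
    exact mul_ne_zero (pow_ne_zero _ hs) hA
  have hs' : ((|s| : ℝ) : ℂ) ≠ 0 := by exact_mod_cast abs_ne_zero.mpr hs
  have hc : IsEpsteinContinuation (s • lattice A) (s • x) (s⁻¹ • y)
      (epsteinZeta (s • lattice A) (s • x) (s⁻¹ • y)) := by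
    rw [smul_lattice]
    exact isEpsteinContinuation_epsteinZeta hsA _ _
  have e : ∀ z, z ∈ lattice A \ {x} ↔
      MulAction.toPerm (Units.mk0 s hs) z ∈ s • lattice A \ {s • x} := by
    intro z
    change _ ↔ s • z ∈ _
    simp only [Set.mem_sdiff, Set.mem_singleton_iff, Set.smul_mem_smul_set_iff₀ hs,
      (smul_right_injective _ hs).eq_iff]
  refine hc.mul_of_equiv (fun ν => ?_) (fun ν => ?_)
    ((MulAction.toPerm (Units.mk0 s hs)).subtypeEquiv e) fun z ν => ?_
  · exact differentiableAt_id.const_cpow (Or.inl hs')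
  · exact (Complex.cpow_ne_zero_iff).mpr (Or.inl hs')
  · change _ = _ * epsteinSummand (s • x) (s⁻¹ • y) ν (s • (z : EuclideanSpace ℝ (Fin d)))
    have hsν : ((|s| : ℝ) : ℂ) ^ ν ≠ 0 := (Complex.cpow_ne_zero_iff).mpr (Or.inl hs')
    rw [epsteinSummand, epsteinSummand, ← smul_sub, norm_smul, Real.norm_eq_abs,
      real_inner_smul_left, real_inner_smul_right, inv_mul_cancel_left₀ hs, Complex.ofReal_mul,
      Complex.mul_cpow_ofReal_nonneg (abs_nonneg _) (norm_nonneg _), ← div_div,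
      div_right_comm, mul_div_cancel₀ _ hsν]

end symmetry

end

theorem mainTheorem7 (d : ℕ) (A : Matrix (Fin d) (Fin d) ℝ) (hA : A.det ≠ 0)
    (x y : EuclideanSpace ℝ (Fin d)) (ν : ℂ) (hν : y ∈ reciprocalLattice A → ν ≠ (d : ℂ)) :
    -- `Z` is well defined: it continues the lattice sum, and `ν` is not a pole
    (IsEpsteinContinuation (lattice A) x y (epsteinZeta (lattice A) x y) ∧
      AnalyticAt ℂ (epsteinZeta (lattice A) x y) ν) ∧
    -- inversion symmetry
    (epsteinZeta (lattice A) (-x) y ν = epsteinZeta (lattice A) x (-y) ν ∧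
      epsteinZeta (lattice A) (-x) (-y) ν = epsteinZeta (lattice A) x y ν) ∧
    -- translation symmetry
    (∀ u ∈ lattice A, ∀ v ∈ reciprocalLattice A,
      epsteinZeta (lattice A) (x + u) (y + v) ν =
        Complex.exp (-2 * Real.pi * Complex.I * (inner ℝ y u : ℝ)) *
          epsteinZeta (lattice A) x y ν) ∧
    -- scale symmetry
    (∀ s : ℝ, s ≠ 0 →
      epsteinZeta (lattice A) x y ν =
        ((|s| : ℝ) : ℂ) ^ ν * epsteinZeta (s • lattice A) (s • x) (s⁻¹ • y) ν) := by
  refine ⟨⟨isEpsteinContinuation_epsteinZeta hA x y, ?_⟩, ⟨?_, ?_⟩, fun u hu v hv => ?_,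
    fun s hs => ?_⟩
  · obtain ⟨f, hf, hfa⟩ := exists_isEpsteinContinuation hA x y
    rw [hf.eq_epsteinZeta hA]
    exact hfa ν hν
  · rw [epsteinZeta_neg_left hA]
  · rw [epsteinZeta_neg_left hA, neg_neg]
  · exact congrFun (epsteinZeta_add_add hA x y hu hv) ν
  · exact congrFun (epsteinZeta_eq_smul hA x y hs) ν
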